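/- Let $(R,\mathfrak m)$ be a commutative Artinian local ring with canonical module $\omega$ (that is, $\omega$ is an injective hull of $R/\mathfrak m$), and let $I$ be an ideal of $R$. Write $\lambda$ for length, $b_0(I)$ for the minimal number of generators of $I$, and let $\omega_1$ be the first syzygy in a minimal free resolution of $\omega$, i.e. the kernel of a surjection $R^{n}\to\omega$ with kernel contained in $\mathfrak m R^{n}$. Assume that $\operatorname{Soc}(R)=\mathfrak m I$, where $\operatorname{Soc}(R)=\{x\in R : \mathfrak m x=0\}$, that $b_0(I)>1$, and that $$\lambda(\omega_1/I\omega_1)\le\lambda(\omega/I\omega).$$ Then $$\lambda(\mathfrak m I)\le\frac{\lambda(R/I)+b_0(I)}{b_0(I)-1}.$$ In particular, if in addition $b_0(I)>\lambda(R/I)+2$, then $R$ is Gorenstein (i.e. $R$ has finite injective dimension as a module over itself). -/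

import Mathlib

universe u

/-- The socle of a module `M` over a local ring `(R, 𝔪)`: the elements of `M` killed by `𝔪`. -/
def localSocle (R : Type u) [CommRing R] [IsLocalRing R]
    (M : Type u) [AddCommGroup M] [Module R M] : Submodule R M :=
  Submodule.torsionBySet R M (IsLocalRing.maximalIdeal R : Set R)

/-- `E` is an injective hull of `M`: it is injective and contains (a copy of) `M` as an
essential submodule. -/
def IsInjectiveHull (R : Type u) [CommRing R] (M : Type u) [AddCommGroup M] [Module R M]
    (E : Type u) [AddCommGroup E] [Module R E] : Prop :=
  Module.Injective R E ∧
    ∃ ι : M →ₗ[R] E, Function.Injective ι ∧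
      ∀ N : Submodule R E, N ≠ ⊥ → LinearMap.range ι ⊓ N ≠ ⊥

/-- `ω` is a canonical (dualizing) module of the Artinian local ring `R`: an injective hull of
the residue field. -/
def IsArtinianCanonicalModule (R : Type u) [CommRing R] [IsLocalRing R] [IsArtinianRing R]
    (ω : Type u) [AddCommGroup ω] [Module R ω] : Prop :=
  IsInjectiveHull R (IsLocalRing.ResidueField R) ω

/-- `π : R ^ n → M` is the augmentation of a minimal free resolution of `M`, i.e. it is onto and
its kernel lies in `𝔪 R ^ n`. Then `n` is the zeroth Betti number of `M` and `ker π` is the first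
syzygy of `M`. -/
def IsMinimalFreeCover {R : Type u} [CommRing R] [IsLocalRing R]
    {M : Type u} [AddCommGroup M] [Module R M] {n : ℕ} (π : (Fin n → R) →ₗ[R] M) : Prop :=
  Function.Surjective π ∧
    LinearMap.ker π ≤ IsLocalRing.maximalIdeal R • (⊤ : Submodule R (Fin n → R))

/-- A local ring is Gorenstein if it is Noetherian and has finite injective dimension as a module
over itself. -/
def IsGorensteinLocalRing (R : Type u) [CommRing R] [IsLocalRing R] : Prop :=
  IsNoetherianRing R ∧
    ∃ n : ℕ, CategoryTheory.HasInjectiveDimensionLE (ModuleCat.of R R) n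

/-! Put `s = λ(𝔪I)`, `a = λ(R/I)`, `b = b₀(I)` and let `n` be the rank of the cover. By Nakayama
`λ(R) = s + b + a`. Since `λ(ω) ≤ λ(R)`, the syzygy `ω₁ = ker π` has length at least `(n - 1) λ(R)`.
Minimality puts `Iω₁` inside `(𝔪I)ⁿ`, and `λ(ω₁/Iω₁) ≤ λ(ω/Iω) ≤ na`, so `λ(ω₁) ≤ ns + na`.
Comparing gives `nb ≤ a + b + s`. Faithfulness of `ω` gives `s = λ(Soc R) ≤ n`, hence `s(b - 1) ≤ a
+ b`. If `b > a + 2`, this forces `s ≤ 1`; then `R` embeds in `ω`, and comparing lengths gives `R ≅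
ω`, which is injective. -/

open IsLocalRing

section

variable {R : Type u} [CommRing R]

/-! ### Lengths of quotients. -/

theorem length_eq_submodule_add_quotient {M : Type u} [AddCommGroup M] [Module R M]
    (N : Submodule R M) : Module.length R M = Module.length R N + Module.length R (M ⧸ N) :=
  Module.length_eq_add_of_exact N.subtype N.mkQ N.subtype_injective N.mkQ_surjective
    (LinearMap.exact_subtype_mkQ N)

theorem length_quotient_smul_top_le {M : Type u} [AddCommGroup M] [Module R M] {n : ℕ}
    (π : (Fin n → R) →ₗ[R] M) (hπ : Function.Surjective π) (I : Ideal R) :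
    Module.length R (M ⧸ (I • (⊤ : Submodule R M))) ≤ n * Module.length R (R ⧸ I) := by
  let f : (Fin n → R ⧸ I) →ₗ[R] M ⧸ (I • (⊤ : Submodule R M)) :=
    LinearMap.lsum R (fun _ => R ⧸ I) R fun i =>
      Submodule.liftQ I (LinearMap.toSpanSingleton R _
        (Submodule.Quotient.mk (π (Pi.single i 1)))) fun a ha => by
          rw [LinearMap.mem_ker, LinearMap.toSpanSingleton_apply, ← Submodule.Quotient.mk_smul,
            Submodule.Quotient.mk_eq_zero]
          exact Submodule.smul_mem_smul ha trivial
  have hf : Function.Surjective f := by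
    intro y
    obtain ⟨x, rfl⟩ := Submodule.Quotient.mk_surjective _ y
    obtain ⟨v, rfl⟩ := hπ x
    refine ⟨fun i => Submodule.Quotient.mk (v i), ?_⟩
    have hv : π v = ∑ i, v i • π (Pi.single i 1) := by
      conv_lhs => rw [← Finset.univ_sum_single v]
      rw [map_sum]
      refine Finset.sum_congr rfl fun i _ => ?_
      rw [← map_smul, ← Pi.single_smul, smul_eq_mul, mul_one]
    rw [hv, ← Submodule.mkQ_apply, map_sum]
    simp only [f, LinearMap.lsum_apply, LinearMap.sum_apply, LinearMap.comp_apply,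
      LinearMap.proj_apply, Submodule.liftQ_apply, LinearMap.toSpanSingleton_apply, map_smul,
      Submodule.mkQ_apply]
  refine (Module.length_le_of_surjective f hf).trans ?_
  simp

variable [IsLocalRing R]

/-! ### Socles and the injective hull of the residue field. -/

theorem mem_localSocle_iff {M : Type u} [AddCommGroup M] [Module R M] {x : M} :
    x ∈ localSocle R M ↔ ∀ a ∈ maximalIdeal R, a • x = 0 := by
  simp [localSocle, Submodule.mem_torsionBySet_iff]

/-- Every nonzero element of a module over an Artinian local ring has a nonzero multiple in the
socle. -/
theorem exists_smul_mem_localSocle [IsArtinianRing R] {M : Type u} [AddCommGroup M] [Module R M]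
    {x : M} (hx : x ≠ 0) : ∃ r : R, r • x ≠ 0 ∧ r • x ∈ localSocle R M := by
  classical
  have hex : ∃ k : ℕ, ∀ a ∈ maximalIdeal R ^ k, a • x = 0 := by
    obtain ⟨k, hk⟩ := IsArtinianRing.isNilpotent_jacobson_bot (R := R)
    refine ⟨k, fun a ha => ?_⟩
    rw [IsLocalRing.jacobson_eq_maximalIdeal ⊥ bot_ne_top] at hk
    rw [hk] at ha
    rw [show a = 0 from ha, zero_smul]
  -- The least power of `𝔪` killing `x` is not the zeroth, as `x ≠ 0`; a multiplier from the power
  -- just below it lands in the socle.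
  obtain ⟨k, hk⟩ : ∃ k, Nat.find hex = k + 1 := by
    refine Nat.exists_eq_succ_of_ne_zero fun h0 => hx ?_
    have := Nat.find_spec hex
    rw [h0] at this
    simpa using this 1 (by simp)
  have h1 := Nat.find_spec hex
  have h2 := Nat.find_min hex (m := k) (by omega)
  push Not at h2
  obtain ⟨r, hr, hrx⟩ := h2
  refine ⟨r, hrx, mem_localSocle_iff.2 fun a ha => ?_⟩
  rw [smul_smul]
  refine h1 _ ?_
  rw [hk, pow_succ']
  exact Ideal.mul_mem_mul ha hr

/-- By essentiality a nonzero socle element has a nonzero multiple in the copy of the residue field,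
and the multiplier must be a unit. -/
theorem IsInjectiveHull.length_localSocle_le_one {ω : Type u} [AddCommGroup ω] [Module R ω]
    (hω : IsInjectiveHull R (ResidueField R) ω) : Module.length R (localSocle R ω) ≤ 1 := by
  obtain ⟨-, ι, hι, hess⟩ := hω
  have hle : localSocle R ω ≤ LinearMap.range ι := by
    intro x hx
    by_cases hx0 : x = 0
    · simp [hx0]
    obtain ⟨y, hy, hy0⟩ := (Submodule.ne_bot_iff _).1
      (hess (Submodule.span R {x}) (by simpa [Submodule.span_singleton_eq_bot] using hx0))
    obtain ⟨hy1, hy2⟩ := Submodule.mem_inf.1 hy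
    obtain ⟨r, rfl⟩ := Submodule.mem_span_singleton.1 hy2
    have hr : IsUnit r := by
      by_contra hr
      exact hy0 (mem_localSocle_iff.1 hx r ((mem_maximalIdeal r).2 hr))
    obtain ⟨u, rfl⟩ := hr
    simpa [smul_smul] using Submodule.smul_mem _ (↑u⁻¹ : R) hy1
  have hk : Module.length R (ResidueField R) = 1 := by
    have : IsSimpleModule R (R ⧸ maximalIdeal R) :=
      isSimpleModule_iff_isCoatom.2 (maximalIdeal.isMaximal R).out
    exact Module.length_eq_one R (R ⧸ maximalIdeal R)
  calc Module.length R (localSocle R ω)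
      ≤ Module.length R (LinearMap.range ι) :=
        Module.length_le_of_injective (Submodule.inclusion hle) (Submodule.inclusion_injective hle)
    _ = 1 := by rw [← (LinearEquiv.ofInjective ι hι).length_eq, hk]

/-- The injective hull of the residue field of an Artinian local ring is faithful. -/
theorem IsInjectiveHull.exists_smul_ne_zero [IsArtinianRing R]
    {ω : Type u} [AddCommGroup ω] [Module R ω]
    (hω : IsInjectiveHull R (ResidueField R) ω) {s : R} (hs : s ≠ 0) : ∃ w : ω, s • w ≠ 0 := by
  obtain ⟨hinj, ι, hι, -⟩ := hω
  obtain ⟨r, ht0, ht⟩ := exists_smul_mem_localSocle (R := R) hs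
  let f : (R ⧸ maximalIdeal R) →ₗ[R] R :=
    Submodule.liftQ (maximalIdeal R) (LinearMap.toSpanSingleton R R (r • s)) fun a ha =>
      mem_localSocle_iff.1 ht a ha
  have hf1 : f (Submodule.Quotient.mk 1) = r • s := one_smul R (r • s)
  have hf : Function.Injective f := by
    have : IsSimpleModule R (R ⧸ maximalIdeal R) :=
      isSimpleModule_iff_isCoatom.2 (maximalIdeal.isMaximal R).out
    refine (LinearMap.injective_or_eq_zero f).resolve_right fun h => ht0 ?_
    rw [← hf1, h, LinearMap.zero_apply]
  -- Extend `ι` along the embedding of the residue field in `R` sending `1` to `r • s`; then `s • h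
  -- 1 ≠ 0`.
  obtain ⟨h, hh⟩ := hinj.out f hf ι
  refine ⟨h 1, fun h0 => ?_⟩
  have h1 : h (r • s) = ι 1 := by
    rw [← hf1]
    exact hh _
  have h2 : h (r • s) = 0 := by
    rw [map_smul, ← mul_one s, ← smul_eq_mul, map_smul, h0, smul_zero]
  exact one_ne_zero (hι (by rw [← h1, h2, map_zero]) : (1 : ResidueField R) = 0)

/-- Dévissage: the only prime is `𝔪`, evaluation at a generator embeds `Hom(R/𝔪, ω)` in the socle of
`ω`, and left exactness of `Hom` handles extensions. -/
theorem length_linearMap_le [IsArtinianRing R] {ω : Type u} [AddCommGroup ω] [Module R ω]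
    (hω : Module.length R (localSocle R ω) ≤ 1)
    {M : Type u} [AddCommGroup M] [Module R M] (hM : Module.Finite R M) :
    Module.length R (M →ₗ[R] ω) ≤ Module.length R M := by
  induction hM using IsNoetherianRing.induction_on_isQuotientEquivQuotientPrime R with
  | subsingleton N =>
    have : Subsingleton (N →ₗ[R] ω) := ⟨fun f g => by ext x; simp [Subsingleton.elim x 0]⟩
    simp
  | quotient N p e =>
    have hp : p.asIdeal = maximalIdeal R :=
      eq_maximalIdeal (IsArtinianRing.isMaximal_of_isPrime p.asIdeal)
    have : IsSimpleModule R (R ⧸ p.asIdeal) := by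
      rw [hp]
      exact isSimpleModule_iff_isCoatom.2 (maximalIdeal.isMaximal R).out
    rw [e.length_eq, Module.length_eq_one R (R ⧸ p.asIdeal)]
    let ev : (N →ₗ[R] ω) →ₗ[R] localSocle R ω :=
      LinearMap.codRestrict _ (LinearMap.applyₗ (R := R) (e.symm (Submodule.Quotient.mk 1)))
        fun f => mem_localSocle_iff.2 fun a ha => by
          rw [← hp] at ha
          have h0 : a • (Submodule.Quotient.mk 1 : R ⧸ p.asIdeal) = 0 := by
            rw [← Submodule.Quotient.mk_smul, Submodule.Quotient.mk_eq_zero]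
            simpa using ha
          rw [LinearMap.applyₗ_apply_apply, ← map_smul, ← map_smul, h0, map_zero, map_zero]
    refine (Module.length_le_of_injective ev ?_).trans hω
    intro f g hfg
    have h1 : f (e.symm (Submodule.Quotient.mk 1)) = g (e.symm (Submodule.Quotient.mk 1)) :=
      congrArg Subtype.val hfg
    ext x
    obtain ⟨y, rfl⟩ := e.symm.surjective x
    obtain ⟨r, rfl⟩ := Submodule.Quotient.mk_surjective _ y
    rw [show (Submodule.Quotient.mk r : R ⧸ p.asIdeal) = r • Submodule.Quotient.mk 1 by
      rw [← Submodule.Quotient.mk_smul]; simp]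
    simp only [map_smul, h1]
  | exact N₁ N₂ N₃ f g hf hg hfg h₁ h₃ =>
    rw [Module.length_eq_add_of_exact f g hf hg hfg]
    have hex : Function.Exact (LinearMap.lcomp R ω g) (LinearMap.lcomp R ω f) := by
      exact LinearMap.exact_lcomp_of_exact_of_surjective ω hfg hg
    have hinj : Function.Injective (LinearMap.lcomp R ω g) :=
      LinearMap.lcomp_injective_of_surjective g hg
    rw [Module.length_eq_add_of_exact (LinearMap.lcomp R ω g)
      (LinearMap.lcomp R ω f).rangeRestrict hinj (LinearMap.surjective_rangeRestrict _)
      (by intro x; rw [← hex x]; simp [Subtype.ext_iff]), add_comm (Module.length R N₁)]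
    gcongr
    exact (Module.length_le_of_injective _ (Submodule.subtype_injective _)).trans h₁

theorem IsInjectiveHull.length_le [IsArtinianRing R]
    {ω : Type u} [AddCommGroup ω] [Module R ω]
    (hω : IsInjectiveHull R (ResidueField R) ω) : Module.length R ω ≤ Module.length R R := by
  rw [← (LinearMap.ringLmapEquivSelf R R ω).length_eq]
  exact length_linearMap_le hω.length_localSocle_le_one inferInstance

/-- The type of an Artinian local ring is at most the number of generators of its canonical
module. -/
theorem IsInjectiveHull.length_localSocle_self_le [IsArtinianRing R]
    {ω : Type u} [AddCommGroup ω] [Module R ω]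
    (hω : IsInjectiveHull R (ResidueField R) ω) {n : ℕ} (π : (Fin n → R) →ₗ[R] ω)
    (hπ : Function.Surjective π) : Module.length R (localSocle R R) ≤ n := by
  let f : localSocle R R →ₗ[R] Fin n → localSocle R ω :=
    LinearMap.pi fun i => LinearMap.codRestrict _
      (LinearMap.toSpanSingleton R ω (π (Pi.single i 1)) ∘ₗ Submodule.subtype _)
      fun s => mem_localSocle_iff.2 fun a ha => by
        have := mem_localSocle_iff.1 s.2 a ha
        simp only [LinearMap.comp_apply, Submodule.subtype_apply, LinearMap.toSpanSingleton_apply,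
          smul_smul]
        rw [← smul_eq_mul, this, zero_smul]
  have hf : Function.Injective f := by
    rw [injective_iff_map_eq_zero]
    intro s hs
    by_contra hs0
    obtain ⟨w, hw⟩ := hω.exists_smul_ne_zero (s := (s : R)) (by simpa using hs0)
    obtain ⟨v, rfl⟩ := hπ w
    apply hw
    have h0 : (s : R) • π = 0 := by
      ext i
      have := congrArg Subtype.val (congrFun hs i)
      simpa [f] using this
    exact LinearMap.congr_fun h0 v
  calc Module.length R (localSocle R R)
      ≤ Module.length R (Fin n → localSocle R ω) := Module.length_le_of_injective f hf
    _ = n * Module.length R (localSocle R ω) := by simp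
    _ ≤ n * 1 := by gcongr; exact hω.length_localSocle_le_one
    _ = n := mul_one _

/-- An Artinian local ring whose socle has length at most one is self-injective. -/
theorem IsInjectiveHull.injective_self [IsArtinianRing R]
    {ω : Type u} [AddCommGroup ω] [Module R ω]
    (hω : IsInjectiveHull R (ResidueField R) ω) (hs : Module.length R (localSocle R R) ≤ 1) :
    Module.Injective R R := by
  obtain ⟨r, hx0, hx⟩ := exists_smul_mem_localSocle (R := R) (one_ne_zero : (1 : R) ≠ 0)
  obtain ⟨w, hw⟩ := hω.exists_smul_ne_zero hx0
  have hnt : Nontrivial (localSocle R R) := ⟨⟨_, hx⟩, 0, fun h => hx0 (congrArg Subtype.val h)⟩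
  have hsimple : IsSimpleModule R (localSocle R R) :=
    Module.length_eq_one_iff.1 (le_antisymm hs (Order.one_le_iff_pos.2 Module.length_pos))
  -- Every nonzero `a` has the fixed socle element `r • 1` as a multiple, and that element does not
  -- kill `w`.
  have hinj : Function.Injective (LinearMap.toSpanSingleton R ω w) := by
    rw [injective_iff_map_eq_zero]
    intro a ha
    by_contra ha0
    obtain ⟨b, hb0, hb⟩ := exists_smul_mem_localSocle (R := R) ha0
    obtain ⟨c, hc⟩ := IsSimpleModule.toSpanSingleton_surjective R
      (m := (⟨_, hb⟩ : localSocle R R)) (fun h => hb0 (congrArg Subtype.val h)) ⟨_, hx⟩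
    have hc' : c • b • a = r • (1 : R) := congrArg Subtype.val hc
    apply hw
    have ha' : a • w = 0 := ha
    rw [← hc', smul_assoc, smul_assoc, ha', smul_zero, smul_zero]
  have htop : LinearMap.range (LinearMap.toSpanSingleton R ω w) = ⊤ := by
    have hfin : Module.length R ω ≠ ⊤ := ne_top_of_le_ne_top Module.length_ne_top hω.length_le
    have hfl := isFiniteLength_iff_isNoetherian_isArtinian.1 (Module.length_ne_top_iff.1 hfin)
    have := hfl.1
    have := hfl.2
    by_contra hne
    have h1 := Submodule.length_lt hne
    rw [← (LinearEquiv.ofInjective _ hinj).length_eq] at h1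
    exact absurd hω.length_le (not_le.2 h1)
  let e := LinearEquiv.ofBijective _ ⟨hinj, LinearMap.range_eq_top.1 htop⟩
  exact ((Module.Baer.of_injective hω.1).of_equiv e.symm).injective

theorem isGorensteinLocalRing_of_injective [IsNoetherianRing R] (h : Module.Injective R R) :
    IsGorensteinLocalRing R := by
  -- Dimension at most `0` means less than `1`.
  refine ⟨inferInstance, 0, ?_⟩
  have := Module.injective_object_of_injective_module R R
  exact (CategoryTheory.injective_iff_hasInjectiveDimensionLT_one (X := ModuleCat.of R R)).1 this

/-! ### Lengths attached to `I` and to the syzygy. -/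

theorem length_ideal_eq_add [IsNoetherianRing R] (I : Ideal R) :
    Module.length R I =
      Module.length R ↥(maximalIdeal R * I) + (Submodule.spanFinrank I : ℕ∞) := by
  have hmap : (maximalIdeal R • (⊤ : Submodule R I)).map I.subtype = maximalIdeal R * I := by
    rw [Submodule.map_smul'', Submodule.map_top, Submodule.range_subtype, smul_eq_mul]
  rw [length_eq_submodule_add_quotient (maximalIdeal R • (⊤ : Submodule R I)),
    (Submodule.equivMapOfInjective I.subtype (Submodule.subtype_injective _) _).length_eq, hmap,
    spanFinrank_eq_finrank_quotient I I.fg_of_isNoetherianRing]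
  let := Ideal.Quotient.field (maximalIdeal R)
  have : Module.Finite (R ⧸ maximalIdeal R) (I ⧸ maximalIdeal R • (⊤ : Submodule R I)) :=
    Module.Finite.of_restrictScalars_finite R _ _
  rw [← Module.length_eq_finrank,
    Module.length_eq_of_surjective (S := R) (R := R ⧸ maximalIdeal R)
      (M := I ⧸ maximalIdeal R • (⊤ : Submodule R I)) Ideal.Quotient.mk_surjective]

theorem IsMinimalFreeCover.length_smul_ker_le {M : Type u} [AddCommGroup M] [Module R M] {n : ℕ}
    {π : (Fin n → R) →ₗ[R] M} (hπ : IsMinimalFreeCover π) (I : Ideal R) :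
    Module.length R ↥(I • (⊤ : Submodule R (LinearMap.ker π))) ≤
      n * Module.length R ↥(maximalIdeal R * I) := by
  have hmem : ∀ x ∈ I • (⊤ : Submodule R (LinearMap.ker π)), ∀ i,
      (x : Fin n → R) i ∈ maximalIdeal R * I := by
    intro x hx i
    induction hx using Submodule.smul_induction_on' with
    | smul a ha y _ =>
      have hy : (y : Fin n → R) i ∈ maximalIdeal R := by
        have h1 := hπ.2 y.2
        generalize (y : Fin n → R) = z at h1
        induction h1 using Submodule.smul_induction_on' with
        | smul b hb w _ => exact Ideal.mul_mem_right _ _ hb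
        | add w _ w' _ h h' => exact add_mem h h'
      rw [mul_comm]
      exact Ideal.mul_mem_mul ha hy
    | add y _ z _ hy hz => exact add_mem hy hz
  let f : (I • (⊤ : Submodule R (LinearMap.ker π)) : Submodule R (LinearMap.ker π)) →ₗ[R]
      Fin n → ↥(maximalIdeal R * I) :=
    LinearMap.pi fun i => LinearMap.codRestrict _
      (LinearMap.proj i ∘ₗ Submodule.subtype _ ∘ₗ Submodule.subtype _) fun x => hmem x x.2 i
  have hf : Function.Injective f := by
    intro x y hxy
    ext i
    exact congrArg Subtype.val (congrFun hxy i)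
  refine (Module.length_le_of_injective f hf).trans ?_
  simp

end

theorem mainTheorem10
    {R : Type u} [CommRing R] [IsLocalRing R] [IsArtinianRing R]
    (I : Ideal R)
    (ω : Type u) [AddCommGroup ω] [Module R ω]
    (hω : IsArtinianCanonicalModule R ω)
    {n : ℕ} (π : (Fin n → R) →ₗ[R] ω) (hπ : IsMinimalFreeCover π)
    (hsoc : localSocle R R = IsLocalRing.maximalIdeal R * I)
    (hI : 1 < Submodule.spanFinrank I)
    (hlen :
      Module.length R
          (LinearMap.ker π ⧸ (I • (⊤ : Submodule R (LinearMap.ker π)))) ≤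
        Module.length R (ω ⧸ (I • (⊤ : Submodule R ω)))) :
    (((Module.length R ↥(IsLocalRing.maximalIdeal R * I)).toNat : ℚ) ≤
        (((Module.length R (R ⧸ I)).toNat : ℚ) + (Submodule.spanFinrank I : ℚ)) /
          ((Submodule.spanFinrank I : ℚ) - 1)) ∧
      (Module.length R (R ⧸ I) + 2 < (Submodule.spanFinrank I : ℕ∞) →
        IsGorensteinLocalRing R) := by
  replace hω : IsInjectiveHull R (ResidueField R) ω := hω
  have hfin : ∀ (M : Type u) [AddCommGroup M] [Module R M] [Module.Finite R M],
      ∃ k : ℕ, Module.length R M = k := fun M _ _ _ =>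
    ⟨_, (ENat.natCast_toNat Module.length_ne_top).symm⟩
  have : Module.Finite R ω := Module.Finite.of_surjective π hπ.1
  obtain ⟨s, hs⟩ := hfin ↥(maximalIdeal R * I)
  obtain ⟨a, ha⟩ := hfin (R ⧸ I)
  obtain ⟨l, hl⟩ := hfin R
  obtain ⟨lI, hlI⟩ := hfin I
  obtain ⟨lω, hlω⟩ := hfin ω
  obtain ⟨q, hq⟩ := hfin (ω ⧸ (I • (⊤ : Submodule R ω)))
  obtain ⟨k, hk⟩ := hfin (LinearMap.ker π)
  obtain ⟨k₁, hk₁⟩ := hfin ↥(I • (⊤ : Submodule R (LinearMap.ker π)))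
  obtain ⟨k₂, hk₂⟩ := hfin (LinearMap.ker π ⧸ (I • (⊤ : Submodule R (LinearMap.ker π))))
  have e1 := length_eq_submodule_add_quotient I
  have e2 := length_ideal_eq_add I
  have e3 := Module.length_eq_add_of_exact (LinearMap.ker π).subtype π
    (Submodule.subtype_injective _) hπ.1 π.exact_subtype_ker_map
  have e4 := length_eq_submodule_add_quotient (I • (⊤ : Submodule R (LinearMap.ker π)))
  have i1 := hω.length_le
  have i2 := hω.length_localSocle_self_le π hπ.1
  have i3 := length_quotient_smul_top_le π hπ.1 I
  have i4 := hπ.length_smul_ker_le I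
  simp only [Module.length_pi, ENat.card_eq_coe_fintype_card, Fintype.card_fin] at e3
  rw [hsoc] at i2
  rw [hl, hlI, ha] at e1
  rw [hlI, hs] at e2
  rw [hl, hk, hlω] at e3
  rw [hk, hk₁, hk₂] at e4
  rw [hlω, hl] at i1
  rw [hs] at i2
  rw [hq, ha] at i3
  rw [hk₁, hs] at i4
  rw [hk₂, hq] at hlen
  generalize hb : Submodule.spanFinrank I = b at *
  norm_cast at e1 e2 e3 e4 i1 i2 i3 i4 hlen
  -- The terms `ns` and `na` cancel from `n(a + b + s) ≤ (a + b + s) + ns + na`.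
  have key : n * b ≤ a + b + s := by
    subst e1 e2
    nlinarith
  have key' : s * b ≤ a + b + s := (Nat.mul_le_mul_right b i2).trans key
  refine ⟨?_, fun hab => ?_⟩
  · rw [hs, ha, ENat.toNat_natCast, ENat.toNat_natCast, le_div_iff₀ (by
      have : (1 : ℚ) < b := by exact_mod_cast hI
      linarith)]
    have : (s * b : ℚ) ≤ a + b + s := by exact_mod_cast key'
    linarith
  · rw [ha] at hab
    norm_cast at hab
    have hs1 : s ≤ 1 := by
      -- For `s ≥ 2`, `2(b - 1) ≤ s(b - 1) ≤ a + b` contradicts `a + 2 < b`.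
      by_contra! h
      nlinarith
    refine isGorensteinLocalRing_of_injective (hω.injective_self ?_)
    rw [hsoc, hs]
    exact_mod_cast hs1
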